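/- Let $q$ be a power of a prime $p$, let $n\ge 0$ be an integer and let $(\beta,\beta^q)$ be a normal basis of $\mathbf F_{q^2}$ over $\mathbf F_q$. For $v,w\in\mathbf F_{q^2}^n$ put $$\langle v|w\rangle_a=\operatorname{tr}_{q/p}\left(\frac{v\cdot w^q-v^q\cdot w}{\beta^{2q}-\beta^{2}}\right),$$ where $q$-th powers are taken componentwise and $\operatorname{tr}_{q/p}$ is the trace from $\mathbf F_q$ to $\mathbf F_p$, and let $S^{\perp_a}=\{w : \langle v|w\rangle_a=0 \text{ for all } v\in S\}$. For $S\subseteq \mathbf F_{q^2}^n$ let $\mathrm{wt}(S)$ be the minimum Hamming weight of a vector in $S$ ($\infty$ if $S=\emptyset$). On $(\mathbf C^q)^{\otimes n}$, with orthonormal basis $|x\rangle$, $x\in\mathbf F_q^n$, let $X(a)|x\rangle=|x+a\rangle$ and $Z(b)|x\rangle=\omega^{\operatorname{tr}_{q/p}(b\cdot x)}|x\rangle$ with $\omega=e^{2\pi i/p}$, and let $E=\langle X(a),Z(b) : a,b\in\mathbf F_q^n\rangle$ be the error group. The weight of an error $\alpha X(a)Z(b)\in E$ is the number of $i$ with $a_i\ne0$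 or $b_i\neq 0$. An operator quantum error-correcting code is a subspace $C\subseteq(\mathbf C^q)^{\otimes n}$ with a decomposition $C=A\otimes B$ as a tensor product of Hilbert spaces; let $P$ be the orthogonal projector onto $C$. An error $e$ is detectable by the subsystem $A$ if $PeP$ acts on $C=A\otimes B$ as $1_A\otimes G$ for some operator $G$ on $B$. The minimum distance of $A$ is the minimum weight of an error in $E$ that is not detectable by $A$ ($\infty$ if there is none). The subsystem $A$ can correct a set $S$ of errors if there is a completely positive trace-preserving map $\mathcal R$ such that, for every completely positive map $\Phi$ whose Kraus operators are linear combinations of errors in $S$ and every operator $\sigma$ on $B$, there is an operator $\tau$ on $B$ with $\mathcal R(\Phi(\rho\otimes\sigma))=\rho\otimes\tau$ for all operators $\rho$ on $A$. **Theorem.** Let $X$ be an additive subgroup of $\mathbf F_{q^2}^n$ with $X\ne\{0\}$, and let $Y=X\cap X^{\perp_a}$, $x=|X|$, $y=|Y|$. Then there exists an operator quantum error-correcting code $C=A\otimes B$ in $(\mathbf C^q)^{\otimes n}$ such that (i) $\dim A=q^n/(xy)^{1/2}$, (ii) $\dim B=(x/y)^{1/2}$, and the minimum distance of the subsystem $A$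 is $$d=\mathrm{wt}\big((X+X^{\perp_a})\setminus X\big)=\mathrm{wt}\big(Y^{\perp_a}\setminus X\big).$$ Thus the subsystem $A$ can detect all errors in $E$ of weight less than $d$, and can correct the set of all errors in $E$ of weight at most $\lfloor (d-1)/2\rfloor$ (of any weight if $d=\infty$). -/

import Mathlib

open scoped Matrix Kronecker Pointwise ENat

noncomputable section

/-! ### Operators on `(ℂ^q)^{⊗n}`

The space `(ℂ^q)^{⊗n}` has the orthonormal basis `|x⟩`, `x ∈ F_q^n`; operators on it are written as
matrices indexed by `Fin n → F`, entry `(y, x)` being `⟨y| M |x⟩`. -/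

/-- The tensor product `M 0 ⊗ ⋯ ⊗ M (n - 1)` of operators on `ℂ^q`. -/
def tensorMat {F : Type*} {n : ℕ} (M : Fin n → Matrix F F ℂ) :
    Matrix (Fin n → F) (Fin n → F) ℂ :=
  Matrix.of fun y x => ∏ i, M i (y i) (x i)

theorem tensorMat_unitary {F : Type*} [Fintype F] [DecidableEq F] {n : ℕ}
    (M : Fin n → Matrix F F ℂ) (hM : ∀ i, M i * (M i)ᴴ = 1) :
    tensorMat M ∈ Matrix.unitaryGroup (Fin n → F) ℂ := by
  rw [Matrix.mem_unitaryGroup_iff]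
  ext y x
  simp only [tensorMat, Matrix.mul_apply, Matrix.star_apply, Matrix.of_apply, star_prod,
    ← Finset.prod_mul_distrib]
  have h := Finset.prod_univ_sum (fun _ : Fin n => (Finset.univ : Finset F))
    (fun i z => M i (y i) z * star (M i (x i) z))
  rw [Fintype.piFinset_univ] at h
  rw [← h]
  have h2 : ∀ i, ∑ z, M i (y i) z * star (M i (x i) z) = (1 : Matrix F F ℂ) (y i) (x i) := by
    intro i
    rw [← hM i, Matrix.mul_apply]
    rfl
  simp only [h2, Matrix.one_apply, Finset.prod_ite_zero, Finset.mem_univ, true_imp_iff,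
    Finset.prod_const_one, funext_iff]

/-- `X(a)|x⟩ = |x + a⟩` on `ℂ^q`. -/
def shiftMat {F : Type*} [Field F] [DecidableEq F] (a : F) : Matrix F F ℂ :=
  Matrix.of fun y x => if y = x + a then 1 else 0

/-- `Z(b)|x⟩ = ω^{tr(bx)}|x⟩` on `ℂ^q`, where `ω = exp(2πi/p)` and `tr` is the trace of `F_q` over
`F_p`; `ZMod.stdAddChar j` is `ω^j`. -/
def clockMat (p : ℕ) [Fact p.Prime] {F : Type*} [Field F] [DecidableEq F] [Algebra (ZMod p) F]
    (b : F) : Matrix F F ℂ :=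
  Matrix.diagonal fun x => ZMod.stdAddChar (Algebra.trace (ZMod p) F (b * x))

theorem shiftMat_unitary {F : Type*} [Field F] [Fintype F] [DecidableEq F] (a : F) :
    shiftMat a * (shiftMat a)ᴴ = 1 := by
  ext y x
  simp only [shiftMat, Matrix.mul_apply, Matrix.conjTranspose_apply, Matrix.of_apply,
    Matrix.one_apply, apply_ite star, star_one, star_zero]
  rw [Finset.sum_eq_single (y - a)]
  · simp [eq_comm]
  · intro z _ hz
    rw [if_neg, zero_mul]
    rintro rfl
    simp at hz
  · simp

theorem clockMat_unitary (p : ℕ) [Fact p.Prime] {F : Type*} [Field F] [Fintype F] [DecidableEq F]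
    [Algebra (ZMod p) F] (b : F) : clockMat p b * (clockMat p b)ᴴ = 1 := by
  rw [clockMat, Matrix.diagonal_conjTranspose, Matrix.diagonal_mul_diagonal, ← Matrix.diagonal_one]
  congr 1
  ext x
  simp [ZMod.stdAddChar_apply, Complex.mul_conj]

/-- `X(a) = X(a₁) ⊗ ⋯ ⊗ X(aₙ)`. -/
def errX {F : Type*} [Field F] [Fintype F] [DecidableEq F] {n : ℕ} (a : Fin n → F) :
    Matrix.unitaryGroup (Fin n → F) ℂ :=
  ⟨tensorMat fun i => shiftMat (a i), tensorMat_unitary _ fun _ => shiftMat_unitary _⟩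

/-- `Z(b) = Z(b₁) ⊗ ⋯ ⊗ Z(bₙ)`. -/
def errZ (p : ℕ) [Fact p.Prime] {F : Type*} [Field F] [Fintype F] [DecidableEq F]
    [Algebra (ZMod p) F] {n : ℕ} (b : Fin n → F) : Matrix.unitaryGroup (Fin n → F) ℂ :=
  ⟨tensorMat fun i => clockMat p (b i), tensorMat_unitary _ fun _ => clockMat_unitary p _⟩

/-- The error group `E = ⟨X(a), Z(b) | a, b ∈ F_q^n⟩`. -/
def errorGroup (p : ℕ) [Fact p.Prime] (F : Type*) [Field F] [Fintype F] [DecidableEq F]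
    [Algebra (ZMod p) F] (n : ℕ) : Subgroup (Matrix.unitaryGroup (Fin n → F) ℂ) :=
  Subgroup.closure (Set.range errX ∪ Set.range (errZ p))

/-- `M = α X(a) Z(b)` with a nonzero scalar `α`, and exactly `w` indices `i` have `aᵢ ≠ 0` or
`bᵢ ≠ 0`: the error `M` has weight `w`. (Every element of the error group has exactly one
weight.) -/
def HasErrorWeight (p : ℕ) [Fact p.Prime] {F : Type*} [Field F] [Fintype F] [DecidableEq F]
    [Algebra (ZMod p) F] {n : ℕ} (M : Matrix (Fin n → F) (Fin n → F) ℂ) (w : ℕ) : Prop :=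
  ∃ (α : ℂ) (a b : Fin n → F), α ≠ 0 ∧
    M = α • ((errX a : Matrix (Fin n → F) (Fin n → F) ℂ) * (errZ p b).1) ∧
    (Finset.univ.filter fun i => a i ≠ 0 ∨ b i ≠ 0).card = w

/-! ### Operator quantum error-correcting codes -/

/-- An operator quantum error-correcting code `C = A ⊗ B` with `dim A = a`, `dim B = b` in the
Hilbert space `ℂ^ι`: an isometric embedding `V` of `A ⊗ B = ℂ^a ⊗ ℂ^b = ℂ^{a × b}` into `ℂ^ι`.
The code space `C` is the range of `V`, and an operator `S ⊗ T` on `A ⊗ B` is `S ⊗ₖ T`. -/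
structure OQECC (ι : Type*) [Fintype ι] (a b : ℕ) where
  V : Matrix ι (Fin a × Fin b) ℂ
  isometry : Vᴴ * V = 1

/-- The operator on the Hilbert space that is `S` on `C = A ⊗ B` and zero on the orthogonal
complement of `C`. -/
def OQECC.extend {ι : Type*} [Fintype ι] {a b : ℕ} (Q : OQECC ι a b)
    (S : Matrix (Fin a × Fin b) (Fin a × Fin b) ℂ) : Matrix ι ι ℂ :=
  Q.V * S * Q.Vᴴ

/-- The orthogonal projector onto `C`. -/
def OQECC.proj {ι : Type*} [Fintype ι] {a b : ℕ} (Q : OQECC ι a b) : Matrix ι ι ℂ :=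
  Q.extend 1

/-- The error `e` is detectable by the subsystem `A`: compressed to `C = A ⊗ B` it acts as a scalar
on `A` and arbitrarily on `B`, that is, `P e P = 1_A ⊗ G` on `C` for some operator `G` on `B`. -/
def OQECC.Detects {ι : Type*} [Fintype ι] {a b : ℕ} (Q : OQECC ι a b) (e : Matrix ι ι ℂ) : Prop :=
  ∃ G : Matrix (Fin b) (Fin b) ℂ,
    Q.proj * e * Q.proj = Q.extend ((1 : Matrix (Fin a) (Fin a) ℂ) ⊗ₖ G)

/-- The completely positive map with Kraus operators `K₁, …, Kₘ`. -/
def krausMap {ι : Type*} [Fintype ι] {m : ℕ} (K : Fin m → Matrix ι ι ℂ) (ρ : Matrix ι ι ℂ) :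
    Matrix ι ι ℂ :=
  ∑ k, K k * ρ * (K k)ᴴ

/-- The subsystem `A` corrects the set `S` of errors: there is one recovery operation (a completely
positive trace-preserving map) that restores the state of `A`, whatever the state of `B` is, after
every completely positive map whose Kraus operators are linear combinations of errors in `S`. -/
def OQECC.Corrects {ι : Type*} [Fintype ι] [DecidableEq ι] {a b : ℕ} (Q : OQECC ι a b)
    (S : Set (Matrix ι ι ℂ)) : Prop :=
  ∃ (r : ℕ) (R : Fin r → Matrix ι ι ℂ), ∑ j, (R j)ᴴ * R j = 1 ∧
    ∀ (m : ℕ) (K : Fin m → Matrix ι ι ℂ), (∀ k, K k ∈ Submodule.span ℂ S) →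
      ∀ σ : Matrix (Fin b) (Fin b) ℂ, ∃ τ : Matrix (Fin b) (Fin b) ℂ,
        ∀ ρ : Matrix (Fin a) (Fin a) ℂ,
          krausMap R (krausMap K (Q.extend (ρ ⊗ₖ σ))) = Q.extend (ρ ⊗ₖ τ)

/-- The minimum distance of the subsystem `A`: the least weight of an error in the error group that
is not detectable by `A` (`⊤` if every error is detectable). -/
def OQECC.minDist (p : ℕ) [Fact p.Prime] {F : Type*} [Field F] [Fintype F] [DecidableEq F]
    [Algebra (ZMod p) F] {n a b : ℕ} (Q : OQECC (Fin n → F) a b) : ℕ∞ :=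
  sInf {d : ℕ∞ | ∃ e ∈ errorGroup p F n, ¬ Q.Detects e.1 ∧
    ∃ w : ℕ, HasErrorWeight p e.1 w ∧ d = w}

/-! ### Classical additive codes over `F_{q²}` -/

theorem exists_algebraMap_eq_of_pow_card {F K : Type*} [Field F] [Fintype F] [Field K] [Algebra F K]
    {z : K} (hz : z ^ Fintype.card F = z) : ∃ c : F, algebraMap F K c = z := by
  classical
  by_contra! h
  have hq : 1 < Fintype.card F := Fintype.one_lt_card
  have hne := FiniteField.X_pow_card_sub_X_ne_zero K hq
  have hsub : insert z (Finset.univ.image (algebraMap F K)) ⊆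
      ((Polynomial.X ^ Fintype.card F - Polynomial.X : Polynomial K).roots).toFinset := by
    intro y hy
    rw [Multiset.mem_toFinset, Polynomial.mem_roots hne]
    rcases Finset.mem_insert.1 hy with rfl | hy
    · simp [hz]
    · obtain ⟨c, -, rfl⟩ := Finset.mem_image.1 hy
      simp [← map_pow, FiniteField.pow_card]
  have h1 := Finset.card_le_card hsub
  rw [Finset.card_insert_of_notMem (by simpa using h),
    Finset.card_image_of_injective _ (algebraMap F K).injective, Finset.card_univ] at h1
  have h2 := Multiset.toFinset_card_le
    (Polynomial.X ^ Fintype.card F - Polynomial.X : Polynomial K).roots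
  have h3 := Polynomial.card_roots' (Polynomial.X ^ Fintype.card F - Polynomial.X : Polynomial K)
  rw [FiniteField.X_pow_card_sub_X_natDegree_eq K hq] at h3
  omega

/-- The quotient `(v · w^q - v^q · w) / (β^{2q} - β^2)` lies in `F_q`. -/
theorem exists_altQuotient (F : Type*) {K : Type*} [Field F] [Fintype F] [Field K] [Algebra F K]
    (hK : Module.finrank F K = 2) {n : ℕ} (β : K) (v w : Fin n → K) :
    ∃ c : F, algebraMap F K c =
      (v ⬝ᵥ w ^ Fintype.card F - v ^ Fintype.card F ⬝ᵥ w) /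
        (β ^ (2 * Fintype.card F) - β ^ 2) := by
  have : FiniteDimensional F K := FiniteDimensional.of_finrank_pos (by omega)
  have : Finite K := Module.finite_of_finite F
  have := Fintype.ofFinite K
  have hqq : ∀ x : K, (x ^ Fintype.card F) ^ Fintype.card F = x := by
    intro x
    rw [← pow_mul, ← sq, ← hK, ← Module.card_eq_pow_finrank (K := F) (V := K)]
    exact FiniteField.pow_card x
  apply exists_algebraMap_eq_of_pow_card
  obtain ⟨φ, hφ⟩ : ∃ φ : K →ₐ[F] K, ∀ x : K, φ x = x ^ Fintype.card F :=
    ⟨FiniteField.frobeniusAlgHom F K, fun _ => rfl⟩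
  have hφφ : ∀ x : K, φ (φ x) = x := fun x => by rw [hφ, hφ, hqq]
  rw [pow_mul']
  simp only [dotProduct, Pi.pow_apply, ← hφ, map_div₀, map_sub, map_sum, map_mul, map_pow, hφφ]
  rw [← neg_div_neg_eq, neg_sub, neg_sub]

/-- The trace-alternating form
`⟨v|w⟩_a = tr_{q/p} ((v · w^q - v^q · w) / (β^{2q} - β^2))` on `F_{q²}^n`. -/
def traceAlt (p : ℕ) (F : Type*) {K : Type*} [Field F] [Fintype F] [Algebra (ZMod p) F]
    [Field K] [Algebra F K] (hK : Module.finrank F K = 2) {n : ℕ} (β : K) (v w : Fin n → K) :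
    ZMod p :=
  Algebra.trace (ZMod p) F (Classical.choose (exists_altQuotient F hK β v w))

/-- The dual `S^{⊥_a}` with respect to the trace-alternating form. -/
def altPerp (p : ℕ) (F : Type*) {K : Type*} [Field F] [Fintype F] [Algebra (ZMod p) F]
    [Field K] [Algebra F K] (hK : Module.finrank F K = 2) {n : ℕ} (β : K)
    (S : Set (Fin n → K)) : Set (Fin n → K) :=
  {w | ∀ v ∈ S, traceAlt p F hK β v w = 0}

/-- `wt(S)`: the minimum Hamming weight of a vector in `S` (`⊤` if `S` is empty). -/
def minWt {K : Type*} [Field K] [DecidableEq K] {n : ℕ} (S : Set (Fin n → K)) : ℕ∞ :=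
  ⨅ v ∈ S, (hammingNorm v : ℕ∞)

end

/-! In the coordinates of a vector as `aβ + bβ^q`, the trace-alternating form becomes the symplectic
form `tr(b·a' - a·b')` and Hamming weight becomes the weight of `X(a)Z(b)` (`traceAlt_pairVec`,
`hammingNorm_pairVec`). So X is a subspace of a symplectic space over `F_p`, whose vectors v index
Weyl operators that commute up to the phase given by the form.

Choose a maximal isotropic L in X. It contains Y and is its own orthogonal inside X, hence `|L|² =
xy`. A joint eigenspace of the Weyl operators of L has dimension `q^n/|L|` and serves as A. For a
linear complement N of L in X, the translates of this eigenspace by N carry distinct characters of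
L, hence are mutually orthogonal; C is their sum and B is indexed by N. On C the operators from X
permute the translates up to scalars (`1 ⊗ G`), and those from `X^⊥` act alike on all translates (`M
⊗ 1`), not as scalars unless they come from X. Outside `Y^⊥ = X + X^⊥` an operator changes the
character of Y and compresses to 0. The undetectable vectors are therefore exactly `(X + X^⊥) \ X`
(`exists_subsystem_code_detects`).

For correction, two errors of weight at most t differ by a vector of weight at most 2t < d, which is
detectable; moreover, Weyl operators send C to equal or orthogonal subspaces. Measuring which
subspace occurred and undoing one representative error leaves only an action on B
(`OQECC.corrects_of_detects`). -/

noncomputable section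

/-! ### Weyl operators -/

section Weyl

variable (p : ℕ) [Fact p.Prime] {F : Type*} [Field F] [Algebra (ZMod p) F] {n : ℕ}

/-- The additive character `t ↦ ω^{tr t}` of `F`. -/
def traceChar (F : Type*) [Field F] [Algebra (ZMod p) F] : AddChar F ℂ :=
  (ZMod.stdAddChar (N := p)).compAddMonoidHom (Algebra.trace (ZMod p) F).toAddMonoidHom

theorem traceChar_apply (t : F) :
    traceChar p F t = ZMod.stdAddChar (Algebra.trace (ZMod p) F t) := rfl

theorem norm_stdAddChar (j : ZMod p) : ‖(ZMod.stdAddChar j : ℂ)‖ = 1 :=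
  (ZMod.toCircle j).norm_coe

theorem stdAddChar_eq_one_iff {j : ZMod p} : (ZMod.stdAddChar j : ℂ) = 1 ↔ j = 0 := by
  rw [← AddChar.map_zero_eq_one (ZMod.stdAddChar (N := p))]
  exact (ZMod.injective_stdAddChar).eq_iff

theorem traceChar_ne_zero (t : F) : traceChar p F t ≠ 0 := by
  rw [← norm_ne_zero_iff, traceChar_apply, norm_stdAddChar]
  exact one_ne_zero

theorem star_traceChar (t : F) : star (traceChar p F t) = traceChar p F (-t) := by
  rw [AddChar.map_neg_eq_inv, traceChar_apply, Complex.inv_eq_conj (norm_stdAddChar p _)]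
  rfl

/-- The symplectic form `tr (b · a' - a · b')` on `F^n × F^n`. -/
def sympForm (F : Type*) [Field F] [Algebra (ZMod p) F] (n : ℕ) :
    LinearMap.BilinForm (ZMod p) ((Fin n → F) × (Fin n → F)) :=
  LinearMap.mk₂ (ZMod p) (fun v w => Algebra.trace (ZMod p) F (v.2 ⬝ᵥ w.1 - v.1 ⬝ᵥ w.2))
    (fun v v' w => by simp only [Prod.snd_add, Prod.fst_add, add_dotProduct, map_sub, map_add]; ring)
    (fun c v w => by
      simp only [Prod.smul_snd, Prod.smul_fst, smul_dotProduct, map_sub, map_smul, smul_sub])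
    (fun v w w' => by simp only [Prod.snd_add, Prod.fst_add, dotProduct_add, map_sub, map_add]; ring)
    (fun c v w => by
      simp only [Prod.smul_snd, Prod.smul_fst, dotProduct_smul, map_sub, map_smul, smul_sub])

theorem sympForm_apply (v w : (Fin n → F) × (Fin n → F)) :
    sympForm p F n v w = Algebra.trace (ZMod p) F (v.2 ⬝ᵥ w.1 - v.1 ⬝ᵥ w.2) := rfl

theorem sympForm_isAlt : (sympForm p F n).IsAlt := fun v => by
  rw [sympForm_apply, dotProduct_comm, sub_self, map_zero]

/-- Vectors with a single nonzero entry reduce this to nondegeneracy of the trace form of `F` over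
`F_p`. -/
theorem sympForm_nondegenerate [Fintype F] : (sympForm p F n).Nondegenerate := by
  have hrefl : (sympForm p F n).IsRefl := (sympForm_isAlt p).isRefl
  have htr : ∀ t : F, (∀ s : F, Algebra.trace (ZMod p) F (t * s) = 0) → t = 0 := by
    intro t ht
    have := (traceForm_nondegenerate (ZMod p) F).1 t
    exact this ht
  have key : ∀ v, (∀ w, sympForm p F n v w = 0) → v = 0 := by
    intro v hv
    ext i
    · refine htr _ fun s => ?_
      have := hv (0, Pi.single i s)
      simpa [sympForm_apply] using this
    · refine htr _ fun s => ?_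
      have := hv (Pi.single i s, 0)
      simpa [sympForm_apply] using this
  exact hrefl.nondegenerate_iff_separatingLeft.2 key

variable [DecidableEq F]

/-- The Weyl operator `X(a) Z(b)`. -/
def weyl (v : (Fin n → F) × (Fin n → F)) : Matrix (Fin n → F) (Fin n → F) ℂ :=
  Matrix.of fun y x => if y = x + v.1 then traceChar p F (v.2 ⬝ᵥ x) else 0

theorem weyl_zero : weyl p (0 : (Fin n → F) × (Fin n → F)) = 1 := by
  ext y x
  simp [weyl, Matrix.one_apply]

theorem weyl_conjTranspose (v : (Fin n → F) × (Fin n → F)) :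
    (weyl p v)ᴴ = traceChar p F (v.2 ⬝ᵥ v.1) • weyl p (-v) := by
  ext y x
  simp only [weyl, Matrix.conjTranspose_apply, Matrix.of_apply, Matrix.smul_apply, Prod.fst_neg,
    Prod.snd_neg]
  by_cases h : x = y + v.1
  · subst h
    simp only [if_true, star_traceChar, add_neg_cancel_right, smul_eq_mul, neg_dotProduct,
      dotProduct_add, ← AddChar.map_add_eq_mul]
    congr 1
    ring
  · rw [if_neg h, if_neg, star_zero, smul_zero]
    rintro rfl
    simp at h

variable [Fintype F]

theorem errX_mul_errZ (a b : Fin n → F) : (errX a).1 * (errZ p b).1 = weyl p (a, b) := by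
  have hZ : (errZ p b).1 = Matrix.diagonal fun x => traceChar p F (b ⬝ᵥ x) := by
    ext y x
    simp only [errZ, tensorMat, clockMat, Matrix.of_apply, Matrix.diagonal_apply,
      Finset.prod_ite_zero, Finset.mem_univ, forall_const, ← funext_iff]
    congr 1
    exact (map_prod (traceChar p F).toMonoidHom (fun i => Multiplicative.ofAdd (b i * y i)) _).symm
  rw [hZ]
  ext y x
  rw [Matrix.mul_diagonal]
  simp only [errX, tensorMat, shiftMat, weyl, Matrix.of_apply, Finset.prod_ite_zero,
    Finset.mem_univ, true_imp_iff, Finset.prod_const_one, funext_iff, Pi.add_apply, ite_mul,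
    one_mul, zero_mul]

/-- Only moving `Z(b)` past `X(a')` costs a phase. The exponent is not antisymmetric; its
antisymmetrization is `sympForm`. -/
theorem weyl_mul (v w : (Fin n → F) × (Fin n → F)) :
    weyl p v * weyl p w = traceChar p F (v.2 ⬝ᵥ w.1) • weyl p (v + w) := by
  ext y x
  rw [Matrix.mul_apply, Finset.sum_eq_single (x + w.1)]
  · simp only [weyl, Matrix.of_apply, if_true, Matrix.smul_apply, smul_eq_mul, Prod.fst_add,
      Prod.snd_add, dotProduct_add, add_dotProduct, AddChar.map_add_eq_mul, add_assoc,
      add_comm w.1 v.1]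
    split_ifs <;> ring
  · intro z _ hz
    simp [weyl, hz]
  · simp

theorem weyl_conjTranspose_mul_self (v : (Fin n → F) × (Fin n → F)) :
    (weyl p v)ᴴ * weyl p v = 1 := by
  rw [weyl_conjTranspose, Matrix.smul_mul, weyl_mul, smul_smul, neg_add_cancel, weyl_zero,
    ← AddChar.map_add_eq_mul]
  simp

theorem weyl_mul_conjTranspose_self (v : (Fin n → F) × (Fin n → F)) :
    weyl p v * (weyl p v)ᴴ = 1 :=
  mul_eq_one_comm.1 (weyl_conjTranspose_mul_self p v)

theorem weyl_mul_comm (v w : (Fin n → F) × (Fin n → F)) :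
    weyl p v * weyl p w =
      (ZMod.stdAddChar (sympForm p F n v w) : ℂ) • (weyl p w * weyl p v) := by
  rw [weyl_mul, weyl_mul, smul_smul, sympForm_apply, ← traceChar_apply,
    ← AddChar.map_add_eq_mul, add_comm w v, dotProduct_comm v.1 w.2]
  simp

theorem weyl_commute {v w : (Fin n → F) × (Fin n → F)} (h : sympForm p F n v w = 0) :
    weyl p v * weyl p w = weyl p w * weyl p v := by
  rw [weyl_mul_comm, h, AddChar.map_zero_eq_one, one_smul]

theorem trace_weyl_zero :
    (weyl p (0 : (Fin n → F) × (Fin n → F))).trace = (Fintype.card F : ℂ) ^ n := by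
  rw [weyl_zero, Matrix.trace_one]
  simp

/-- Conjugation by a Weyl operator preserves the trace, but by nondegeneracy some choice multiplies
this operator by a scalar other than 1. -/
theorem trace_weyl_of_ne_zero {v : (Fin n → F) × (Fin n → F)} (hv : v ≠ 0) :
    (weyl p v).trace = 0 := by
  obtain ⟨w, hw⟩ : ∃ w, sympForm p F n v w ≠ 0 := by
    by_contra! h
    exact hv ((sympForm_nondegenerate p).1 v h)
  have h1 : (weyl p v * weyl p w * (weyl p w)ᴴ).trace =
      (ZMod.stdAddChar (sympForm p F n v w) : ℂ) * (weyl p v).trace := by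
    rw [weyl_mul_comm, Matrix.smul_mul, Matrix.trace_smul, Matrix.trace_mul_comm,
      ← Matrix.mul_assoc, weyl_conjTranspose_mul_self, one_mul, smul_eq_mul]
  rw [Matrix.mul_assoc, weyl_mul_conjTranspose_self, mul_one] at h1
  by_contra h0
  exact hw ((stdAddChar_eq_one_iff p).1 (mul_right_cancel₀ h0 (by rw [one_mul]; exact h1.symm)))

theorem weyl_mem_errorGroup (v : (Fin n → F) × (Fin n → F)) :
    ∃ e ∈ errorGroup p F n, e.1 = weyl p v :=
  ⟨errX v.1 * errZ p v.2, mul_mem (Subgroup.subset_closure (Or.inl ⟨_, rfl⟩))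
    (Subgroup.subset_closure (Or.inr ⟨_, rfl⟩)), errX_mul_errZ p v.1 v.2⟩

end Weyl

/-! ### Stabilizer spaces of isotropic subspaces -/

/-- Commuting endomorphisms of a nonzero finite-dimensional space have a common eigenvector. -/
theorem exists_common_eigenvector {k E κ : Type*} [Field k] [IsAlgClosed k] [AddCommGroup E]
    [Module k E] [FiniteDimensional k E] [Nontrivial E] (f : κ → Module.End k E)
    (hf : ∀ i j, Commute (f i) (f j)) : ∃ u : E, u ≠ 0 ∧ ∀ i, ∃ c : k, f i u = c • u := by
  obtain ⟨W, ⟨hW0, hWf⟩, hmin⟩ := exists_minimal_of_wellFoundedLT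
    (fun W : Submodule k E => W ≠ ⊥ ∧ ∀ i, ∀ x ∈ W, f i x ∈ W)
    ⟨⊤, top_ne_bot, fun _ _ _ => Submodule.mem_top⟩
  obtain ⟨u, huW, hu0⟩ := W.ne_bot_iff.1 hW0
  refine ⟨u, hu0, fun i => ?_⟩
  have : Nontrivial W := W.nontrivial_iff_ne_bot.2 hW0
  obtain ⟨c, hc⟩ := Module.End.exists_eigenvalue ((f i).restrict (hWf i))
  obtain ⟨w, hw⟩ := hc.exists_hasEigenvector
  have hfw : f i w = c • (w : E) := congrArg Subtype.val hw.apply_eq_smul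
  -- By commutativity an eigenspace of `f i` inside `W` is again invariant under every `f j`, so
  -- minimality makes it all of `W`.
  have hle := hmin (y := W ⊓ (f i).eigenspace c)
    ⟨(Submodule.ne_bot_iff _).2 ⟨w, ⟨w.2, Module.End.mem_eigenspace_iff.2 hfw⟩, by
        simpa using hw.2⟩,
      fun j x hx => ⟨hWf j x hx.1, Module.End.mem_eigenspace_iff.2 (by
        have h2 := Module.End.mem_eigenspace_iff.1 hx.2
        have h3 := LinearMap.congr_fun (hf i j) x
        simp only [Module.End.mul_apply] at h3
        rw [h3, h2, map_smul])⟩⟩ inf_le_left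
  exact ⟨c, Module.End.mem_eigenspace_iff.1 (hle huW).2⟩

/-- A Hermitian idempotent matrix is `W Wᴴ` for some isometry `W`. -/
theorem exists_isometry_of_isHermitian_of_isIdempotent {ι : Type*} [Fintype ι] [DecidableEq ι]
    {P : Matrix ι ι ℂ} (hP : P.IsHermitian) (hPP : P * P = P) :
    ∃ (k : ℕ) (W : Matrix ι (Fin k) ℂ), Wᴴ * W = 1 ∧ W * Wᴴ = P := by
  classical
  set U : Matrix ι ι ℂ := hP.eigenvectorUnitary.1 with hU
  have hUU : Uᴴ * U = 1 := Matrix.mem_unitaryGroup_iff'.1 hP.eigenvectorUnitary.2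
  have hUU' : U * Uᴴ = 1 := mul_eq_one_comm.1 hUU
  set δ : ι → ℂ := fun i => (hP.eigenvalues i : ℂ) with hδ
  have hspec : P = U * Matrix.diagonal δ * Uᴴ := by
    have h := hP.spectral_theorem
    rw [Unitary.conjStarAlgAut_apply] at h
    exact h
  have hdiag : Matrix.diagonal δ = Uᴴ * P * U := by
    rw [hspec]
    simp only [Matrix.mul_assoc, hUU, mul_one]
    rw [← Matrix.mul_assoc, hUU, one_mul]
  have hδδ : ∀ i, δ i * δ i = δ i := by
    have h : Matrix.diagonal δ * Matrix.diagonal δ = Matrix.diagonal δ := by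
      rw [hdiag]
      calc Uᴴ * P * U * (Uᴴ * P * U) = Uᴴ * P * (U * Uᴴ) * P * U := by
            simp only [Matrix.mul_assoc]
        _ = Uᴴ * (P * P) * U := by rw [hUU', mul_one, Matrix.mul_assoc Uᴴ P P]
        _ = _ := by rw [hPP]
    rw [Matrix.diagonal_mul_diagonal] at h
    exact fun i => congrFun (Matrix.diagonal_injective h) i
  -- Each eigenvalue is 0 or 1; the eigenvectors for 1 are the columns of the isometry.
  let e := (Fintype.equivFin {i // δ i = 1}).symm
  refine ⟨_, U.submatrix id fun j => (e j : ι), ?_, ?_⟩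
  · rw [Matrix.conjTranspose_submatrix, ← Matrix.submatrix_mul _ _ _ id _ Function.bijective_id, hUU]
    ext i j
    simp [Matrix.one_apply, Subtype.val_injective.eq_iff]
  · rw [hspec]
    ext y x
    rw [Matrix.mul_apply, Matrix.mul_apply]
    simp only [Matrix.submatrix_apply, Matrix.conjTranspose_apply, id, Matrix.mul_diagonal]
    rw [e.sum_comp fun i : {i // δ i = 1} => U y i * star (U x i),
      ← Finset.sum_subtype (Finset.univ.filter fun i => δ i = 1) (by simp)
        (fun i => U y i * star (U x i)), Finset.sum_filter]
    refine Finset.sum_congr rfl fun i _ => ?_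
    split_ifs with hi
    · rw [hi, mul_one]
    · have h0 : δ i = 0 := by
        by_contra h0
        exact hi (mul_left_cancel₀ h0 (by rw [hδδ, mul_one]))
      simp [h0]

section Stabilizer

variable (p : ℕ) [Fact p.Prime] {F : Type*} [Field F] [Fintype F] [DecidableEq F]
  [Algebra (ZMod p) F] {n : ℕ}

-- The phases are the eigenvalues on one common eigenvector, so they absorb the cocycle of
-- `weyl_mul`. This treats `p = 2` uniformly, where fourth roots of unity may be needed.
open scoped ComplexOrder in
theorem exists_stabilizer_phase (L : Submodule (ZMod p) ((Fin n → F) × (Fin n → F)))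
    (hL : ∀ v ∈ L, ∀ w ∈ L, sympForm p F n v w = 0) :
    ∃ phase : (Fin n → F) × (Fin n → F) → ℂ, (∀ v ∈ L, ‖phase v‖ = 1) ∧ phase 0 = 1 ∧
      ∀ v ∈ L, ∀ w ∈ L,
        phase v * phase w = traceChar p F (v.2 ⬝ᵥ w.1) * phase (v + w) := by
  classical
  obtain ⟨u, hu0, hu⟩ := exists_common_eigenvector (fun v : L => Matrix.toLin' (weyl p v.1))
    (fun v w => by
      rw [Commute, SemiconjBy, Module.End.mul_eq_comp, Module.End.mul_eq_comp,
        ← Matrix.toLin'_mul, ← Matrix.toLin'_mul, weyl_commute p (hL _ v.2 _ w.2)])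
  choose c hc using hu
  simp only [Matrix.toLin'_apply] at hc
  have hinj : ∀ s t : ℂ, s • u = t • u → s = t := fun s t h => smul_left_injective ℂ hu0 h
  refine ⟨fun v => if h : v ∈ L then c ⟨v, h⟩ else 0, fun v hv => ?_, ?_, fun v hv w hw => ?_⟩
  · simp only [hv, dif_pos]
    have h1 : star (c ⟨v, hv⟩ • u) ⬝ᵥ (c ⟨v, hv⟩ • u) = star u ⬝ᵥ u := by
      rw [← hc, Matrix.star_mulVec, ← Matrix.dotProduct_mulVec, Matrix.mulVec_mulVec,
        weyl_conjTranspose_mul_self, Matrix.one_mulVec]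
    rw [star_smul, smul_dotProduct, dotProduct_smul, smul_smul, smul_eq_mul] at h1
    have h2 := mul_right_cancel₀ (mt dotProduct_star_self_eq_zero.1 hu0)
      (h1.trans (one_mul _).symm)
    have h3 : ‖c ⟨v, hv⟩‖ * ‖c ⟨v, hv⟩‖ = 1 := by
      have h4 := congrArg norm h2
      rwa [norm_mul, norm_star, norm_one] at h4
    nlinarith [norm_nonneg (c ⟨v, hv⟩)]
  · simp only [L.zero_mem, dif_pos]
    refine hinj _ _ ?_
    rw [← hc, weyl_zero, Matrix.one_mulVec, one_smul]
  · simp only [hv, hw, L.add_mem hv hw, dif_pos]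
    refine hinj _ _ ?_
    rw [mul_smul, mul_smul, ← hc ⟨v + w, _⟩, smul_comm, ← hc ⟨v, hv⟩, ← Matrix.mulVec_smul,
      ← hc ⟨w, hw⟩, Matrix.mulVec_mulVec, weyl_mul, Matrix.smul_mulVec]

/-- The joint eigenspace of the Weyl operators of an isotropic subspace `L`: it has dimension
`q^n / |L|`. -/
theorem exists_stabilizer_isometry (L : Submodule (ZMod p) ((Fin n → F) × (Fin n → F)))
    (hL : ∀ v ∈ L, ∀ w ∈ L, sympForm p F n v w = 0) :
    ∃ (k : ℕ) (W : Matrix (Fin n → F) (Fin k) ℂ), Wᴴ * W = 1 ∧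
      k * Nat.card L = Fintype.card F ^ n ∧
      (∀ v ∈ L, ∃ c : ℂ, star c * c = 1 ∧ weyl p v * W = c • W) ∧
      (∀ v, v ∉ L → (Wᴴ * weyl p v * W).trace = 0) ∧
      ∀ v, (∀ w ∈ L, sympForm p F n v w = 0) →
        ∃ M : Matrix (Fin k) (Fin k) ℂ, weyl p v * W = W * M := by
  classical
  obtain ⟨c, hc1, hc0, hcm⟩ := exists_stabilizer_phase p L hL
  have hcard : (Nat.card L : ℂ) ≠ 0 := Nat.cast_ne_zero.2 Nat.card_pos.ne'
  have hcs : ∀ v ∈ L, c v * star (c v) = 1 := fun v hv => by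
    rw [Complex.star_def, Complex.mul_conj, Complex.normSq_eq_norm_sq, hc1 v hv]
    simp
  -- Averaging over `L` gives the projector onto the space where each Weyl operator of `l ∈ L` acts
  -- as `c l`.
  set P : Matrix (Fin n → F) (Fin n → F) ℂ :=
    (Nat.card L : ℂ)⁻¹ • ∑ l : L, star (c l) • weyl p l.1 with hP
  have hlP : ∀ v ∈ L, weyl p v * P = c v • P := by
    intro v hv
    rw [hP, Matrix.mul_smul, smul_comm (c v), Matrix.mul_sum]
    congr 1
    rw [Finset.smul_sum]
    refine Fintype.sum_equiv (Equiv.addLeft (⟨v, hv⟩ : L)) _ _ fun l => ?_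
    rw [Matrix.mul_smul, weyl_mul, smul_smul, smul_smul]
    simp only [Equiv.coe_addLeft, Submodule.coe_add]
    congr 1
    have h1 := hcm v hv l l.2
    have h2 := hcs l l.2
    have h3 := hcs _ (L.add_mem hv l.2)
    linear_combination (-(traceChar p F (v.2 ⬝ᵥ l.1.1) * star (c l))) * h3
      - star (c l) * star (c (v + l)) * h1 + c v * star (c (v + l)) * h2
  have hlP' : ∀ v ∈ L, (weyl p v)ᴴ * P = star (c v) • P := by
    intro v hv
    have h : P = c v • ((weyl p v)ᴴ * P) := by
      rw [← Matrix.mul_smul, ← hlP v hv, ← Matrix.mul_assoc, weyl_conjTranspose_mul_self, one_mul]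
    conv_rhs => rw [h]
    rw [smul_smul, mul_comm, hcs v hv, one_smul]
  -- This one identity yields both self-adjointness and idempotence.
  have hPP' : Pᴴ * P = P := by
    conv_lhs => enter [1]; rw [hP]
    rw [Matrix.conjTranspose_smul, Matrix.conjTranspose_sum, Matrix.smul_mul, Matrix.sum_mul]
    have : ∀ l : L, (star (c l) • weyl p l.1)ᴴ * P = P := fun l => by
      rw [Matrix.conjTranspose_smul, star_star, Matrix.smul_mul, hlP' l l.2, smul_smul,
        hcs l l.2, one_smul]
    rw [Finset.sum_congr rfl fun l _ => this l, Finset.sum_const, Finset.card_univ,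
      ← Nat.card_eq_fintype_card, ← Nat.cast_smul_eq_nsmul ℂ, smul_smul]
    simp
  have hPh : P.IsHermitian := by
    rw [← hPP']
    exact Matrix.isHermitian_conjTranspose_mul_self P
  have htr : ∀ v, (weyl p v * P).trace =
      (Nat.card L : ℂ)⁻¹ * ∑ l : L, star (c l) * traceChar p F (v.2 ⬝ᵥ l.1.1) *
        (weyl p (v + l.1)).trace := by
    intro v
    rw [hP, Matrix.mul_smul, Matrix.mul_sum, Matrix.trace_smul, Matrix.trace_sum, smul_eq_mul]
    congr 1
    refine Finset.sum_congr rfl fun l _ => ?_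
    rw [Matrix.mul_smul, weyl_mul, smul_smul, Matrix.trace_smul, smul_eq_mul]
  obtain ⟨k, W, hW, hWP⟩ := exists_isometry_of_isHermitian_of_isIdempotent hPh
    (by conv_lhs => enter [1]; rw [← hPh.eq]
        exact hPP')
  have hPW : P * W = W := by rw [← hWP, Matrix.mul_assoc, hW, Matrix.mul_one]
  refine ⟨k, W, hW, ?_, fun v hv => ⟨c v, ?_, ?_⟩, fun v hv => ?_, fun v hv => ⟨Wᴴ * weyl p v * W, ?_⟩⟩
  -- The trace of `P` is its rank `k`, and only the term `l = 0` contributes to it.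
  · have h1 := htr 0
    rw [Finset.sum_eq_single 0 (fun l _ hl => by
        rw [zero_add, trace_weyl_of_ne_zero p (by simpa using hl), mul_zero]) (by simp),
      weyl_zero, one_mul, ← hWP, Matrix.trace_mul_comm, hW, Matrix.trace_one] at h1
    simp only [Submodule.coe_zero, hc0, add_zero, trace_weyl_zero] at h1
    simp only [Fintype.card_fin, star_one, Prod.snd_zero, zero_dotProduct,
      AddChar.map_zero_eq_one, one_mul] at h1
    rw [eq_inv_mul_iff_mul_eq₀ hcard, mul_comm] at h1
    exact_mod_cast h1
  · rw [mul_comm, hcs v hv]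
  · rw [← hPW, ← Matrix.mul_assoc, hlP v hv, Matrix.smul_mul]
  -- For `v ∉ L` no `v + l` vanishes, so every term is traceless.
  · rw [Matrix.trace_mul_comm, ← Matrix.mul_assoc, hWP, Matrix.trace_mul_comm, htr]
    rw [Finset.sum_eq_zero, mul_zero]
    intro l _
    rw [trace_weyl_of_ne_zero, mul_zero]
    intro h
    exact hv (by rw [eq_neg_of_add_eq_zero_left h]; exact L.neg_mem l.2)
  · have hcomm : weyl p v * P = P * weyl p v := by
      rw [hP, Matrix.mul_smul, Matrix.smul_mul, Matrix.mul_sum, Matrix.sum_mul]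
      congr 1
      refine Finset.sum_congr rfl fun l _ => ?_
      rw [Matrix.mul_smul, Matrix.smul_mul, weyl_commute p (hv l l.2)]
    calc weyl p v * W = weyl p v * P * W := by rw [Matrix.mul_assoc, hPW]
      _ = W * Wᴴ * weyl p v * W := by rw [hcomm, hWP]
      _ = _ := by simp only [Matrix.mul_assoc]

end Stabilizer

/-! ### Alternating forms -/

namespace LinearMap.BilinForm

variable {k V : Type*} [Field k] [AddCommGroup V] [Module k V] [FiniteDimensional k V]
  {B : LinearMap.BilinForm k V}

/-- A subspace contains an isotropic subspace that is its own orthogonal there. -/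
theorem IsAlt.exists_maximal_isotropic (hB : B.IsAlt) (X : Submodule k V) :
    ∃ L ≤ X, (∀ v ∈ L, ∀ w ∈ L, B v w = 0) ∧ ∀ x ∈ X, (∀ l ∈ L, B x l = 0) → x ∈ L := by
  obtain ⟨L, ⟨hLX, hL⟩, hmax⟩ := exists_maximal_of_wellFoundedGT
    (fun L : Submodule k V => L ≤ X ∧ ∀ v ∈ L, ∀ w ∈ L, B v w = 0)
    ⟨⊥, bot_le, fun v hv w _ => by rw [(Submodule.mem_bot k).1 hv]; simp⟩
  refine ⟨L, hLX, hL, fun x hx hxL => ?_⟩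
  -- Adjoining `x` keeps the subspace isotropic because `B x x = 0`.
  refine hmax (y := L ⊔ k ∙ x)
    ⟨sup_le hLX ((Submodule.span_singleton_le_iff_mem _ _).2 hx), fun v hv w hw => ?_⟩
    le_sup_left (Submodule.mem_sup_right (Submodule.mem_span_singleton_self x))
  obtain ⟨l, hl, y, hy, rfl⟩ := Submodule.mem_sup.1 hv
  obtain ⟨l', hl', y', hy', rfl⟩ := Submodule.mem_sup.1 hw
  obtain ⟨s, rfl⟩ := Submodule.mem_span_singleton.1 hy
  obtain ⟨t, rfl⟩ := Submodule.mem_span_singleton.1 hy'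
  have h1 : B l x = 0 := by rw [← hB.neg_eq, hxL l hl, neg_zero]
  simp [hL l hl l' hl', h1, hxL l' hl', hB x]

/-- Inside `X`, the subspace `L` is its own orthogonal and contains the radical of the restricted
form, so the dimension formula for orthogonals counts `L` twice. -/
theorem IsAlt.two_mul_finrank_maximal_isotropic (hB : B.IsAlt) {X L : Submodule k V} (hLX : L ≤ X)
    (hL : ∀ v ∈ L, ∀ w ∈ L, B v w = 0) (hmax : ∀ x ∈ X, (∀ l ∈ L, B x l = 0) → x ∈ L) :
    Module.finrank k L + Module.finrank k L =
      Module.finrank k X + Module.finrank k (X ⊓ B.orthogonal X : Submodule k V) := by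
  have hcomm : ∀ v w, B v w = 0 → B w v = 0 := fun v w => hB.isRefl v w
  have hrefl : (B.restrict X).IsRefl := fun v w => hcomm v w
  have h := finrank_add_finrank_orthogonal hrefl (L.comap X.subtype)
  have h1 : (B.restrict X).orthogonal (L.comap X.subtype) = L.comap X.subtype := by
    ext x
    rw [mem_orthogonal_iff]
    refine ⟨fun hx => hmax x x.2 fun l hl => hcomm _ _ (hx ⟨l, hLX hl⟩ hl), fun hx y hy =>
      hL _ hy _ hx⟩
  have h2 : (L.comap X.subtype ⊓ (B.restrict X).orthogonal ⊤).map X.subtype =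
      X ⊓ B.orthogonal X := by
    ext x
    simp only [Submodule.mem_map, Submodule.mem_inf, mem_orthogonal_iff, Submodule.mem_comap]
    constructor
    · rintro ⟨y, ⟨-, hy⟩, rfl⟩
      exact ⟨y.2, fun z hz => hy ⟨z, hz⟩ trivial⟩
    · rintro ⟨hx, hxX⟩
      exact ⟨⟨x, hx⟩, ⟨hmax x hx fun l hl => hcomm _ _ (hxX l (hLX hl)), fun z _ => hxX z z.2⟩, rfl⟩
  rw [h1, (Submodule.comapSubtypeEquivOfLe hLX).finrank_eq, ← Submodule.finrank_map_subtype_eq X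
    (L.comap X.subtype ⊓ _), h2] at h
  exact h

/-- The orthogonal of the sum is the intersection, by double orthogonality of `X`; take orthogonals
once more. -/
theorem Nondegenerate.orthogonal_inf_orthogonal (hB : B.Nondegenerate) (hrefl : B.IsRefl)
    (X : Submodule k V) : B.orthogonal (X ⊓ B.orthogonal X) = X ⊔ B.orthogonal X := by
  have h : B.orthogonal (X ⊔ B.orthogonal X) = X ⊓ B.orthogonal X := by
    apply le_antisymm
    · refine le_inf ?_ (orthogonal_le le_sup_left)
      exact (orthogonal_le le_sup_right).trans (orthogonal_orthogonal hB hrefl X).le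
    · rintro x ⟨hx, hxX⟩
      rw [mem_orthogonal_iff]
      intro y hy
      obtain ⟨v, hv, w, hw, rfl⟩ := Submodule.mem_sup.1 hy
      rw [map_add, LinearMap.add_apply, hxX v hv, hrefl _ _ (hw x hx), add_zero]
  rw [← h, orthogonal_orthogonal hB hrefl]

end LinearMap.BilinForm

/-! ### Matrices with blocks of columns -/

section BlockCols

variable {ι α κ : Type*} [Fintype ι] [Fintype α] [Fintype κ]

/-- The matrix whose column `(i, j)` is column `i` of `C j`. -/
def blockCols (C : κ → Matrix ι α ℂ) : Matrix ι (α × κ) ℂ :=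
  Matrix.of fun y ij => C ij.2 y ij.1

omit [Fintype α] [Fintype κ] in
theorem mul_blockCols (M : Matrix ι ι ℂ) (C : κ → Matrix ι α ℂ) :
    M * blockCols C = blockCols fun j => M * C j := rfl

omit [Fintype α] [Fintype κ] in
theorem blockCols_conjTranspose_mul_apply (C C' : κ → Matrix ι α ℂ) (x y : α × κ) :
    ((blockCols C)ᴴ * blockCols C') x y = ((C x.2)ᴴ * C' y.2) x.1 y.1 := rfl

-- An operator on the second factor recombines whole blocks, whereas one on the first factor acts
-- within each block.
omit [Fintype ι] in
theorem blockCols_mul_one_kronecker [DecidableEq α] (C : κ → Matrix ι α ℂ) (G : Matrix κ κ ℂ) :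
    blockCols C * ((1 : Matrix α α ℂ) ⊗ₖ G) = blockCols fun j => ∑ j', G j' j • C j' := by
  ext y ⟨i, j⟩
  rw [Matrix.mul_apply, Fintype.sum_prod_type, Finset.sum_eq_single i]
  · simp [blockCols, Matrix.sum_apply, mul_comm]
  · intro i' _ hi
    simp [hi]
  · simp

omit [Fintype ι] in
theorem blockCols_mul_kronecker_one [DecidableEq κ] (C : κ → Matrix ι α ℂ) (M : Matrix α α ℂ) :
    blockCols C * (M ⊗ₖ (1 : Matrix κ κ ℂ)) = blockCols fun j => C j * M := by
  ext y ⟨i, j⟩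
  rw [Matrix.mul_apply, Fintype.sum_prod_type_right, Finset.sum_eq_single j]
  · simp [blockCols, Matrix.mul_apply]
  · intro i' _ hi
    simp [hi]
  · simp

end BlockCols

/-! ### Subsystem codes from additive subgroups -/

section SubsystemCode

theorem OQECC.detects_iff {ι : Type*} [Fintype ι] {a b : ℕ} (Q : OQECC ι a b) (e : Matrix ι ι ℂ) :
    Q.Detects e ↔ ∃ G : Matrix (Fin b) (Fin b) ℂ,
      Q.Vᴴ * e * Q.V = (1 : Matrix (Fin a) (Fin a) ℂ) ⊗ₖ G := by
  refine exists_congr fun G => ?_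
  simp only [OQECC.proj, OQECC.extend, Matrix.mul_one]
  constructor
  · intro h
    have h1 := congrArg (fun M => Q.Vᴴ * M * Q.V) h
    simpa only [Matrix.mul_assoc, Q.isometry, Matrix.mul_one, ← Matrix.mul_assoc Q.Vᴴ Q.V,
      Matrix.one_mul] using h1
  · intro h
    rw [← h]
    simp only [Matrix.mul_assoc]

theorem OQECC.detects_smul {ι : Type*} [Fintype ι] {a b : ℕ} {Q : OQECC ι a b}
    {e : Matrix ι ι ℂ} (h : Q.Detects e) (c : ℂ) : Q.Detects (c • e) := by
  obtain ⟨G, hG⟩ := (Q.detects_iff e).1 h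
  exact (Q.detects_iff _).2 ⟨c • G, by
    rw [Matrix.mul_smul, Matrix.smul_mul, hG, Matrix.kronecker_smul]⟩

variable (p : ℕ) [Fact p.Prime] {F : Type*} [Field F] [Fintype F] [DecidableEq F]
  [Algebra (ZMod p) F] {n : ℕ}

theorem exists_weyl_add (v w : (Fin n → F) × (Fin n → F)) :
    ∃ c : ℂ, weyl p (v + w) = c • (weyl p v * weyl p w) :=
  ⟨(traceChar p F (v.2 ⬝ᵥ w.1))⁻¹, by
    rw [weyl_mul, smul_smul, inv_mul_cancel₀ (traceChar_ne_zero p _), one_smul]⟩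

theorem exists_weyl_conjTranspose_mul (v w : (Fin n → F) × (Fin n → F)) :
    ∃ c : ℂ, (weyl p v)ᴴ * weyl p w = c • weyl p (w - v) :=
  ⟨_, by rw [weyl_conjTranspose, Matrix.smul_mul, weyl_mul, smul_smul, neg_add_eq_sub]⟩

/-- The operator of `v` multiplies the eigenvalue of the operator of `l` by a nontrivial root of
unity, and eigenvectors of a unitary for distinct eigenvalues are orthogonal. -/
theorem conjTranspose_mul_weyl_mul_eq_zero {α β : Type*} {v l : (Fin n → F) × (Fin n → F)}
    {W : Matrix (Fin n → F) α ℂ} {W' : Matrix (Fin n → F) β ℂ} {c : ℂ} (hc : star c * c = 1)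
    (hW : weyl p l * W = c • W) (hW' : weyl p l * W' = c • W') (h : sympForm p F n l v ≠ 0) :
    Wᴴ * weyl p v * W' = 0 := by
  have h1 : Wᴴ * weyl p v * W' =
      (ZMod.stdAddChar (sympForm p F n l v) : ℂ) • (Wᴴ * weyl p v * W') := by
    calc Wᴴ * weyl p v * W' = Wᴴ * ((weyl p l)ᴴ * weyl p l) * weyl p v * W' := by
          rw [weyl_conjTranspose_mul_self, Matrix.mul_one]
      _ = (weyl p l * W)ᴴ * (weyl p l * weyl p v) * W' := by
          rw [Matrix.conjTranspose_mul]
          simp only [Matrix.mul_assoc]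
      _ = star c • (ZMod.stdAddChar (sympForm p F n l v) : ℂ) •
            (Wᴴ * weyl p v * (weyl p l * W')) := by
          rw [hW, weyl_mul_comm, Matrix.conjTranspose_smul, Matrix.smul_mul, Matrix.mul_smul,
            Matrix.smul_mul, Matrix.smul_mul]
          simp only [Matrix.mul_assoc]
      _ = _ := by
          rw [hW', Matrix.mul_smul, smul_smul, smul_smul, mul_right_comm, hc, one_mul]
  have h2 : (1 - (ZMod.stdAddChar (sympForm p F n l v) : ℂ)) • (Wᴴ * weyl p v * W') = 0 := by
    rw [sub_smul, one_smul, ← h1, sub_self]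
  exact (smul_eq_zero.1 h2).resolve_left fun h0 =>
    h ((stdAddChar_eq_one_iff p).1 (sub_eq_zero.1 h0).symm)

/-- The code `A ⊗ B` of an additive subgroup `X`: the Weyl operators of `X` act on `B`, those of
`Xᗮ` act on `A`, and those outside `(X ∩ Xᗮ)ᗮ` map the code to its orthogonal complement. -/
theorem exists_subsystem_code (X : Submodule (ZMod p) ((Fin n → F) × (Fin n → F))) :
    ∃ (a b l : ℕ) (Q : OQECC (Fin n → F) a b),
      a * l = Fintype.card F ^ n ∧ b * l = Nat.card X ∧
      l * l = Nat.card X *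
        Nat.card (X ⊓ (sympForm p F n).orthogonal X : Submodule (ZMod p) _) ∧
      (∀ v ∈ X, ∃ G : Matrix (Fin b) (Fin b) ℂ,
        weyl p v * Q.V = Q.V * ((1 : Matrix (Fin a) (Fin a) ℂ) ⊗ₖ G)) ∧
      (∀ v ∈ (sympForm p F n).orthogonal X, ∃ M : Matrix (Fin a) (Fin a) ℂ,
        weyl p v * Q.V = Q.V * (M ⊗ₖ (1 : Matrix (Fin b) (Fin b) ℂ))) ∧
      (∀ v ∉ (sympForm p F n).orthogonal (X ⊓ (sympForm p F n).orthogonal X),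
        Q.Vᴴ * weyl p v * Q.V = 0) ∧
      ∀ v ∈ (sympForm p F n).orthogonal X, v ∉ X → ¬ Q.Detects (weyl p v) := by
  classical
  have halt : (sympForm p F n).IsAlt := sympForm_isAlt p
  have hcomm : ∀ {v w}, sympForm p F n v w = 0 → sympForm p F n w v = 0 :=
    fun {v w} => halt.isRefl v w
  obtain ⟨L, hLX, hL, hmax⟩ := halt.exists_maximal_isotropic X
  obtain ⟨N, hLN, rfl⟩ := IsModularLattice.exists_disjoint_and_sup_eq hLX
  set X := L ⊔ N with hX
  obtain ⟨k, W, hW, hk, hWL, htr, hWperp⟩ := exists_stabilizer_isometry p L hL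
  have hk0 : (k : ℂ) ≠ 0 := by
    rintro h
    rw [Nat.cast_eq_zero.1 h, zero_mul] at hk
    exact (pow_pos Fintype.card_pos n).ne hk
  let e := Finite.equivFin N
  let g : Fin (Nat.card N) → (Fin n → F) × (Fin n → F) := fun j => (e.symm j : N)
  have hgN : ∀ j, g j ∈ N := fun j => (e.symm j).2
  have hgX : ∀ j, g j ∈ X := fun j => Submodule.mem_sup_right (hgN j)
  have hginj : Function.Injective g := Subtype.val_injective.comp e.symm.injective
  let C : Fin (Nat.card N) → Matrix (Fin n → F) (Fin k) ℂ := fun j => weyl p (g j) * W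
  have hCC : ∀ j, (C j)ᴴ * C j = 1 := fun j => by
    rw [Matrix.conjTranspose_mul, Matrix.mul_assoc, ← Matrix.mul_assoc (weyl p (g j))ᴴ,
      weyl_conjTranspose_mul_self, Matrix.one_mul, hW]
  have hCC' : ∀ j j', j ≠ j' → (C j)ᴴ * C j' = 0 := fun j j' hj => by
    obtain ⟨c, hc⟩ := exists_weyl_conjTranspose_mul p (g j) (g j')
    rw [Matrix.conjTranspose_mul, Matrix.mul_assoc, ← Matrix.mul_assoc (weyl p (g j))ᴴ, hc,
      Matrix.smul_mul, Matrix.mul_smul, ← Matrix.mul_assoc]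
    -- Since `N` meets `L` trivially, maximality of `L` supplies an `l ∈ L` that separates the two
    -- translates.
    have hd : g j' - g j ∉ L := fun h =>
      hj (hginj (sub_eq_zero.1 (Submodule.disjoint_def.1 hLN _ h
        (N.sub_mem (hgN j') (hgN j)))).symm)
    obtain ⟨l, hl, hld⟩ : ∃ l ∈ L, sympForm p F n (g j' - g j) l ≠ 0 := by
      by_contra! h
      exact hd (hmax _ (X.sub_mem (hgX j') (hgX j)) h)
    obtain ⟨c', hc', hlW⟩ := hWL l hl
    rw [conjTranspose_mul_weyl_mul_eq_zero p hc' hlW hlW fun h => hld (hcomm h), smul_zero]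
  let Q : OQECC (Fin n → F) k (Nat.card N) := ⟨blockCols C, by
    ext ⟨i, j⟩ ⟨i', j'⟩
    rw [blockCols_conjTranspose_mul_apply]
    by_cases h : j = j'
    · subst h
      simp [hCC, Matrix.one_apply]
    · simp [hCC' j j' h, h]⟩
  have hfin : Module.finrank (ZMod p) N + Module.finrank (ZMod p) L =
      Module.finrank (ZMod p) X := by
    have h := Submodule.finrank_sup_add_finrank_inf_eq L N
    rw [disjoint_iff.1 hLN, finrank_bot] at h
    rw [← hX] at h
    omega
  have hcard : ∀ U : Submodule (ZMod p) ((Fin n → F) × (Fin n → F)),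
      Nat.card U = p ^ Module.finrank (ZMod p) U := fun U => by
    rw [Module.natCard_eq_pow_finrank (K := ZMod p), Nat.card_zmod]
  refine ⟨k, Nat.card N, Nat.card L, Q, hk, ?_, ?_, fun v hv => ?_, fun v hv => ?_,
    fun v hv => ?_, fun v hv hvX => ?_⟩
  · rw [hcard, hcard, hcard, ← pow_add, hfin]
  · rw [hcard, hcard, hcard, ← pow_add, ← pow_add,
      halt.two_mul_finrank_maximal_isotropic hLX hL hmax]
  -- Split `v + g j` along `L` and `N`: the `L` part is a scalar on `W`, the `N` part names the
  -- target block.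
  · have h : ∀ j, ∃ (s : ℂ) (j' : Fin (Nat.card N)), weyl p v * C j = s • C j' := fun j => by
      obtain ⟨l, hl, m, hm, hlm⟩ := Submodule.mem_sup.1 (X.add_mem hv (hgX j))
      obtain ⟨s, hs⟩ := exists_weyl_add p m l
      obtain ⟨c, -, hc⟩ := hWL l hl
      refine ⟨traceChar p F (v.2 ⬝ᵥ (g j).1) * (s * c), e ⟨m, hm⟩, ?_⟩
      have hm' : g (e ⟨m, hm⟩) = m := by simp [g]
      simp only [C]
      rw [hm', ← Matrix.mul_assoc, weyl_mul, ← hlm, add_comm l m, hs, Matrix.smul_mul,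
        Matrix.smul_mul, Matrix.mul_assoc, hc, Matrix.mul_smul, smul_smul, smul_smul, mul_assoc]
    choose s σ hs using h
    refine ⟨Matrix.of fun j' j => if j' = σ j then s j else 0, ?_⟩
    change weyl p v * blockCols C = blockCols C * _
    rw [mul_blockCols, blockCols_mul_one_kronecker]
    congr 1
    ext1 j
    simp [hs]
  · obtain ⟨M, hM⟩ := hWperp v fun w hw => hcomm (hv w (hLX hw))
    refine ⟨M, ?_⟩
    change weyl p v * blockCols C = blockCols C * _
    rw [mul_blockCols, blockCols_mul_kronecker_one]
    congr 1
    ext1 j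
    simp only [C]
    rw [← Matrix.mul_assoc, weyl_commute p (hcomm (hv _ (hgX j))), Matrix.mul_assoc, hM,
      Matrix.mul_assoc]
  · obtain ⟨y, ⟨hyX, hyX'⟩, hyv⟩ : ∃ y ∈ X ⊓ (sympForm p F n).orthogonal X,
        sympForm p F n y v ≠ 0 := by
      by_contra! h
      exact hv h
    -- Maximality puts `y` in `L`; as `y` is also orthogonal to every `g j`, it acts on all blocks
    -- by the same scalar.
    obtain ⟨c, hc, hyW⟩ := hWL y (hmax y hyX fun l hl => hcomm (hyX' l (hLX hl)))
    have hyV : weyl p y * Q.V = c • Q.V := by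
      change weyl p y * blockCols C = c • blockCols C
      rw [mul_blockCols]
      have : (fun j => weyl p y * C j) = c • C := by
        ext1 j
        simp only [C, Pi.smul_apply]
        rw [← Matrix.mul_assoc, weyl_commute p (hcomm (hyX' _ (hgX j))), Matrix.mul_assoc, hyW,
          Matrix.mul_smul]
      rw [this]
      rfl
    exact conjTranspose_mul_weyl_mul_eq_zero p hc hyV hyV hyv
  · rw [OQECC.detects_iff]
    rintro ⟨G, hG⟩
    let j : Fin (Nat.card N) := e 0
    -- Detectability would make the action on a single block scalar. Its trace is 0 because `v ∉ L`,
    -- so the action would vanish, although it is by an invertible operator preserving the block.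
    have hblock : Wᴴ * weyl p v * W = G j j • (1 : Matrix (Fin k) (Fin k) ℂ) := by
      have h1 : Wᴴ * weyl p v * W = (C j)ᴴ * (weyl p v * C j) := by
        simp only [C]
        rw [← Matrix.mul_assoc (weyl p v), weyl_commute p (hcomm (hv _ (hgX j))),
          Matrix.conjTranspose_mul]
        simp only [Matrix.mul_assoc]
        rw [← Matrix.mul_assoc (weyl p (g j))ᴴ, weyl_conjTranspose_mul_self, Matrix.one_mul]
      rw [h1]
      ext i i'
      have h2 := congrFun (congrFun hG (i, j)) (i', j)
      rw [Matrix.mul_assoc] at h2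
      change ((C j)ᴴ * (weyl p v * C j)) i i' = _ at h2
      rw [h2]
      rw [Matrix.kroneckerMap_apply, Matrix.smul_apply, smul_eq_mul, mul_comm]
    have h3 := htr v fun h => hvX (hLX h)
    rw [hblock, Matrix.trace_smul, Matrix.trace_one, Fintype.card_fin, smul_eq_mul] at h3
    have h4 : G j j = 0 := (mul_eq_zero.1 h3).resolve_right hk0
    obtain ⟨M, hM⟩ := hWperp v fun w hw => hcomm (hv w (hLX hw))
    have hM0 : M = 0 := by
      rw [h4, zero_smul, Matrix.mul_assoc, hM, ← Matrix.mul_assoc, hW, Matrix.one_mul] at hblock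
      exact hblock
    have hW0 : W = 0 := by
      rw [hM0, Matrix.mul_zero] at hM
      rw [← Matrix.one_mul W, ← weyl_conjTranspose_mul_self p v, Matrix.mul_assoc, hM,
        Matrix.mul_zero]
    have h5 := congrArg Matrix.trace hW
    rw [hW0, Matrix.mul_zero, Matrix.trace_zero, Matrix.trace_one, Fintype.card_fin] at h5
    exact hk0 h5.symm

/-- The Weyl operators detected by the code of `X`, and their commutation with its projector. -/
theorem exists_subsystem_code_detects (X : Submodule (ZMod p) ((Fin n → F) × (Fin n → F))) :
    ∃ (a b l : ℕ) (Q : OQECC (Fin n → F) a b),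
      a * l = Fintype.card F ^ n ∧ b * l = Nat.card X ∧
      l * l = Nat.card X *
        Nat.card (X ⊓ (sympForm p F n).orthogonal X : Submodule (ZMod p) _) ∧
      (∀ v, Q.Detects (weyl p v) ↔ ¬ (v ∈ X ⊔ (sympForm p F n).orthogonal X ∧ v ∉ X)) ∧
      ∀ v, Q.Vᴴ * weyl p v * Q.V = 0 ∨ weyl p v * Q.proj = Q.proj * weyl p v := by
  obtain ⟨a, b, l, Q, h1, h2, h3, hX, hXp, hY, hnd⟩ := exists_subsystem_code p X
  have hYX := (sympForm_nondegenerate p).orthogonal_inf_orthogonal (sympForm_isAlt p).isRefl X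
  rw [hYX] at hY
  have hproj : Q.proj = Q.V * Q.Vᴴ := by rw [OQECC.proj, OQECC.extend, Matrix.mul_one]
  have hrange : ∀ v ∈ X ⊔ (sympForm p F n).orthogonal X,
      ∃ T : Matrix (Fin a × Fin b) (Fin a × Fin b) ℂ, weyl p v * Q.V = Q.V * T := by
    intro v hv
    obtain ⟨x, hx, w, hw, rfl⟩ := Submodule.mem_sup.1 hv
    obtain ⟨c, hc⟩ := exists_weyl_add p x w
    obtain ⟨G, hG⟩ := hX x hx
    obtain ⟨M, hM⟩ := hXp w hw
    exact ⟨c • (_ * _), by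
      rw [hc, Matrix.smul_mul, Matrix.mul_assoc, hM, ← Matrix.mul_assoc, hG, Matrix.mul_assoc,
        Matrix.mul_smul]⟩
  have hPP : ∀ v ∈ X ⊔ (sympForm p F n).orthogonal X,
      Q.proj * weyl p v * Q.proj = weyl p v * Q.proj := by
    intro v hv
    obtain ⟨T, hT⟩ := hrange v hv
    rw [hproj, Matrix.mul_assoc, ← Matrix.mul_assoc (weyl p v), hT]
    simp only [Matrix.mul_assoc]
    rw [← Matrix.mul_assoc Q.Vᴴ, Q.isometry, Matrix.one_mul]
  refine ⟨a, b, l, Q, h1, h2, h3, fun v => ⟨?_, ?_⟩, fun v => ?_⟩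
  · rintro hd ⟨hv, hvX⟩
    obtain ⟨x, hx, w, hw, rfl⟩ := Submodule.mem_sup.1 hv
    have hwX : w ∉ X := fun h => hvX (X.add_mem hx h)
    refine hnd w hw hwX ?_
    rw [OQECC.detects_iff] at hd ⊢
    obtain ⟨G, hG⟩ := hd
    -- Multiplying by the operator of `-x`, which acts only on B, reduces to the component `w` in
    -- the orthogonal of `X`.
    obtain ⟨G', hG'⟩ := hX (-x) (X.neg_mem hx)
    obtain ⟨c, hc⟩ := exists_weyl_add p (x + w) (-x)
    have hw' : x + w + -x = w := by abel
    rw [hw'] at hc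
    refine ⟨c • (G * G'), ?_⟩
    rw [hc, Matrix.mul_smul, Matrix.smul_mul, Matrix.mul_assoc, Matrix.mul_assoc (weyl p (x + w)),
      hG', ← Matrix.mul_assoc, ← Matrix.mul_assoc, hG, ← Matrix.mul_kronecker_mul, Matrix.one_mul,
      Matrix.kronecker_smul]
  · intro h
    rw [OQECC.detects_iff]
    by_cases hv : v ∈ X ⊔ (sympForm p F n).orthogonal X
    · have hvX : v ∈ X := by
        by_contra hvX
        exact h ⟨hv, hvX⟩
      obtain ⟨G, hG⟩ := hX v hvX
      exact ⟨G, by rw [Matrix.mul_assoc, hG, ← Matrix.mul_assoc, Q.isometry, Matrix.one_mul]⟩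
    · exact ⟨0, by rw [hY v hv, Matrix.kronecker_zero]⟩
  · by_cases hv : v ∈ X ⊔ (sympForm p F n).orthogonal X
    · right
      have hadj : Q.projᴴ = Q.proj := by
        rw [hproj, Matrix.conjTranspose_mul, Matrix.conjTranspose_conjTranspose]
      -- The code is invariant under the adjoint too, which turns invariance into commutation with
      -- the projector.
      have h5 := hPP (-v) (neg_mem hv)
      have h6 : Q.proj * (weyl p v)ᴴ * Q.proj = (weyl p v)ᴴ * Q.proj := by
        rw [weyl_conjTranspose, Matrix.mul_smul, Matrix.smul_mul, h5, Matrix.smul_mul]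
      have h7 := congrArg Matrix.conjTranspose h6
      simp only [Matrix.conjTranspose_mul, Matrix.conjTranspose_conjTranspose, hadj] at h7
      rw [← h7, ← Matrix.mul_assoc, hPP v hv]
    · exact Or.inl (hY v hv)

end SubsystemCode

/-! ### Correction of errors -/

/-- A set of unitary errors whose relative errors are detectable is correctable, if any two of the
errors map the code space to the same or to orthogonal subspaces. -/
theorem OQECC.corrects_of_detects {ι κ : Type*} [Fintype ι] [DecidableEq ι] [Fintype κ] {a b : ℕ}
    (Q : OQECC ι a b) (D : κ → Matrix ι ι ℂ) (hD : ∀ i, (D i)ᴴ * D i = 1)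
    (hdet : ∀ i j, Q.Detects ((D i)ᴴ * D j))
    (hproj : ∀ i j, Q.Vᴴ * ((D i)ᴴ * D j) * Q.V = 0 ∨
      D i * Q.proj * (D i)ᴴ = D j * Q.proj * (D j)ᴴ) :
    Q.Corrects {M | ∃ (c : ℂ) (i : κ), M = c • D i} := by
  classical
  have hP : Q.proj = Q.V * Q.Vᴴ := by rw [OQECC.proj, OQECC.extend, Matrix.mul_one]
  have hPP : Q.proj * Q.proj = Q.proj := by
    rw [hP, Matrix.mul_assoc, ← Matrix.mul_assoc Q.Vᴴ, Q.isometry, Matrix.one_mul]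
  have hPV : Q.proj * Q.V = Q.V := by
    rw [hP, Matrix.mul_assoc, Q.isometry, Matrix.mul_one]
  have hPh : Q.projᴴ = Q.proj := by
    rw [hP, Matrix.conjTranspose_mul, Matrix.conjTranspose_conjTranspose]
  -- The projector onto the image of the code under the i-th error. Several errors may share an
  -- image, so `T` collects the distinct projectors.
  let E : κ → Matrix ι ι ℂ := fun i => D i * Q.proj * (D i)ᴴ
  have hEh : ∀ i, (E i)ᴴ = E i := fun i => by
    simp only [E, Matrix.conjTranspose_mul, Matrix.conjTranspose_conjTranspose, hPh,
      Matrix.mul_assoc]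
  have hEE : ∀ i, E i * E i = E i := fun i => by
    calc E i * E i = D i * Q.proj * ((D i)ᴴ * D i) * Q.proj * (D i)ᴴ := by
          simp only [E, Matrix.mul_assoc]
      _ = D i * (Q.proj * Q.proj) * (D i)ᴴ := by
          rw [hD, Matrix.mul_one, Matrix.mul_assoc (D i)]
      _ = _ := by rw [hPP]
  have hED : ∀ i, E i * D i * Q.V = D i * Q.V := fun i => by
    calc E i * D i * Q.V = D i * Q.proj * ((D i)ᴴ * D i) * Q.V := by
          simp only [E, Matrix.mul_assoc]
      _ = _ := by rw [hD, Matrix.mul_one, Matrix.mul_assoc, hPV]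
  have hEE' : ∀ i j, E i ≠ E j → E i * E j = 0 := fun i j hij => by
    have h := (hproj i j).resolve_right hij
    calc E i * E j = D i * Q.V * (Q.Vᴴ * ((D i)ᴴ * D j) * Q.V) * Q.Vᴴ * (D j)ᴴ := by
          simp only [E, hP, Matrix.mul_assoc]
      _ = 0 := by simp only [h, Matrix.mul_zero, Matrix.zero_mul]
  let T := Finset.univ.image E
  have hrep : ∀ t : T, ∃ i, E i = t := fun t => by
    obtain ⟨i, -, hi⟩ := Finset.mem_image.1 t.2
    exact ⟨i, hi⟩
  choose rep hrep using hrep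
  let S : Matrix ι ι ℂ := ∑ t : T, t.1
  have hSh : Sᴴ = S := by
    rw [Matrix.conjTranspose_sum]
    exact Finset.sum_congr rfl fun t _ => by rw [← hrep t, hEh]
  have hSE : ∀ i, S * E i = E i := fun i => by
    rw [Matrix.sum_mul, Finset.sum_eq_single ⟨E i, Finset.mem_image_of_mem _ (Finset.mem_univ i)⟩]
    · exact hEE i
    · intro t _ ht
      rw [← hrep t]
      refine hEE' _ _ fun h => ht (Subtype.ext ?_)
      rw [← hrep t, h]
    · simp
  have hSS : S * S = S := by
    conv_lhs => rw [Matrix.mul_sum]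
    exact Finset.sum_congr rfl fun t _ => by rw [← hrep t, hSE]
  -- Each outcome `t` undoes a representative error; the outcome `none` only completes the map to a
  -- trace-preserving one and annihilates all corrupted code states.
  let R : Option T → Matrix ι ι ℂ := fun o => o.elim (1 - S) fun t => Q.proj * (D (rep t))ᴴ
  have hRsum : ∑ o, (R o)ᴴ * R o = 1 := by
    rw [Fintype.sum_option]
    have h1 : (R none)ᴴ * R none = 1 - S := by
      simp only [R, Option.elim, Matrix.conjTranspose_sub, Matrix.conjTranspose_one, hSh, sub_mul,
        mul_sub, one_mul, mul_one, hSS, sub_self, sub_zero]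
    have h2 : ∀ t : T, (R (some t))ᴴ * R (some t) = t.1 := fun t => by
      simp only [R, Option.elim, Matrix.conjTranspose_mul, Matrix.conjTranspose_conjTranspose, hPh]
      rw [Matrix.mul_assoc, ← Matrix.mul_assoc Q.proj, hPP, ← Matrix.mul_assoc]
      exact hrep t
    rw [h1, Finset.sum_congr rfl fun t _ => h2 t]
    exact sub_add_cancel 1 S
  -- On the code, recovery after an error touches B alone. This condition is linear in the error, so
  -- it passes to the span.
  have hRV : ∀ (o : Option T), ∀ K ∈ Submodule.span ℂ {M | ∃ (c : ℂ) (i : κ), M = c • D i},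
      ∃ G : Matrix (Fin b) (Fin b) ℂ,
        R o * K * Q.V = Q.V * ((1 : Matrix (Fin a) (Fin a) ℂ) ⊗ₖ G) := by
    intro o K hK
    induction hK using Submodule.span_induction with
    | mem M hM =>
      obtain ⟨c, i, rfl⟩ := hM
      cases o with
      | none =>
        refine ⟨0, ?_⟩
        have h : S * D i * Q.V = D i * Q.V := by
          conv_lhs => rw [Matrix.mul_assoc, ← hED, ← Matrix.mul_assoc, ← Matrix.mul_assoc, hSE]
          exact hED i
        simp only [R, Option.elim, Matrix.mul_smul, Matrix.smul_mul, Matrix.sub_mul,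
          Matrix.one_mul, h, sub_self, smul_zero, Matrix.kronecker_zero, Matrix.mul_zero]
      | some t =>
        obtain ⟨G, hG⟩ := (Q.detects_iff _).1 (Q.detects_smul (hdet (rep t) i) c)
        refine ⟨G, ?_⟩
        rw [← hG]
        simp only [R, Option.elim, hP, Matrix.mul_smul, Matrix.smul_mul, Matrix.mul_assoc]
    | zero => exact ⟨0, by simp⟩
    | add M M' _ _ h h' =>
      obtain ⟨G, hG⟩ := h
      obtain ⟨G', hG'⟩ := h'
      exact ⟨G + G', by
        rw [Matrix.mul_add, Matrix.add_mul, hG, hG', Matrix.kronecker_add, Matrix.mul_add]⟩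
    | smul c M _ h =>
      obtain ⟨G, hG⟩ := h
      exact ⟨c • G, by
        rw [Matrix.mul_smul, Matrix.smul_mul, hG, Matrix.kronecker_smul, Matrix.mul_smul]⟩
  let f := (Fintype.equivFin (Option T)).symm
  refine ⟨_, fun j => R (f j), by rw [f.sum_comp fun o => (R o)ᴴ * R o, hRsum],
    fun m K hK σ => ?_⟩
  have h : ∀ j k, ∃ G : Matrix (Fin b) (Fin b) ℂ,
      R (f j) * K k * Q.V = Q.V * ((1 : Matrix (Fin a) (Fin a) ℂ) ⊗ₖ G) :=
    fun j k => hRV (f j) (K k) (hK k)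
  choose G hG using h
  refine ⟨∑ j, ∑ k, G j k * σ * (G j k)ᴴ, fun ρ => ?_⟩
  have hterm : ∀ j k, R (f j) * (K k * Q.extend (ρ ⊗ₖ σ) * (K k)ᴴ) * (R (f j))ᴴ =
      Q.extend (ρ ⊗ₖ (G j k * σ * (G j k)ᴴ)) := fun j k => by
    calc R (f j) * (K k * Q.extend (ρ ⊗ₖ σ) * (K k)ᴴ) * (R (f j))ᴴ =
          (R (f j) * K k * Q.V) * (ρ ⊗ₖ σ) * (R (f j) * K k * Q.V)ᴴ := by
          simp only [OQECC.extend, Matrix.conjTranspose_mul, Matrix.mul_assoc]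
      _ = Q.V * (((1 : Matrix (Fin a) (Fin a) ℂ) ⊗ₖ G j k) * (ρ ⊗ₖ σ) *
            ((1 : Matrix (Fin a) (Fin a) ℂ) ⊗ₖ (G j k)ᴴ)) * Q.Vᴴ := by
          rw [hG, Matrix.conjTranspose_mul, Matrix.conjTranspose_kronecker,
            Matrix.conjTranspose_one]
          simp only [Matrix.mul_assoc]
      _ = _ := by
          rw [← Matrix.mul_kronecker_mul, ← Matrix.mul_kronecker_mul, Matrix.one_mul,
            Matrix.mul_one, OQECC.extend]
  have hlin : ∀ τ : Fin (Fintype.card (Option T)) → Fin m → Matrix (Fin b) (Fin b) ℂ,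
      Q.extend (ρ ⊗ₖ ∑ j, ∑ k, τ j k) = ∑ j, ∑ k, Q.extend (ρ ⊗ₖ τ j k) := fun τ => by
    let φ : Matrix (Fin b) (Fin b) ℂ →+ Matrix ι ι ℂ :=
      { toFun := fun τ => Q.extend (ρ ⊗ₖ τ)
        map_zero' := by simp [OQECC.extend]
        map_add' := fun x y => by
          simp only [OQECC.extend, Matrix.kronecker_add, Matrix.mul_add, Matrix.add_mul] }
    change φ _ = ∑ j, ∑ k, φ (τ j k)
    simp only [map_sum]
  rw [hlin]
  simp only [krausMap, Matrix.mul_sum, Matrix.sum_mul, hterm]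

theorem OQECC.Corrects.mono {ι : Type*} [Fintype ι] [DecidableEq ι] {a b : ℕ} {Q : OQECC ι a b}
    {S T : Set (Matrix ι ι ℂ)} (h : Q.Corrects T) (hST : S ⊆ T) : Q.Corrects S := by
  obtain ⟨r, R, hR, hK⟩ := h
  exact ⟨r, R, hR, fun m K hKS => hK m K fun k => Submodule.span_mono hST (hKS k)⟩

/-! ### The normal basis coordinates -/

section Coordinates

variable {F K : Type*} [Field F] [Field K] [Algebra F K] {n : ℕ}

/-- The vector `a β + b β'` of `K^n`. -/
def pairVec (β β' : K) (n : ℕ) : (Fin n → F) × (Fin n → F) →+ (Fin n → K) where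
  toFun v i := v.1 i • β + v.2 i • β'
  map_zero' := by ext; simp
  map_add' v w := by
    ext i
    simp only [Prod.fst_add, Prod.snd_add, Pi.add_apply, add_smul]
    abel

theorem pairVec_apply (β β' : K) (v : (Fin n → F) × (Fin n → F)) (i : Fin n) :
    pairVec β β' n v i = v.1 i • β + v.2 i • β' := rfl

theorem pairVec_bijective (hK : Module.finrank F K = 2) {β β' : K}
    (hβ : LinearIndependent F ![β, β']) :
    Function.Bijective (pairVec (F := F) β β' n) := by
  constructor
  · rw [injective_iff_map_eq_zero]
    intro v hv
    have h := fun i => LinearIndependent.pair_iff.1 hβ (v.1 i) (v.2 i) (congrFun hv i)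
    ext i
    · exact (h i).1
    · exact (h i).2
  · intro z
    have : FiniteDimensional F K := FiniteDimensional.of_finrank_pos (by omega)
    have hspan := hβ.span_eq_top_of_card_eq_finrank' (by simp [hK])
    have h : ∀ i, ∃ a b : F, a • β + b • β' = z i := fun i => by
      have hz : z i ∈ Submodule.span F (Set.range ![β, β']) := by rw [hspan]; trivial
      rwa [Matrix.range_cons, Matrix.range_cons, Matrix.range_empty, Set.union_empty,
        Set.singleton_union, Submodule.mem_span_pair] at hz
    choose a b hab using h
    exact ⟨(a, b), funext hab⟩

theorem hammingNorm_pairVec [DecidableEq F] [DecidableEq K] {β β' : K}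
    (hβ : LinearIndependent F ![β, β']) (v : (Fin n → F) × (Fin n → F)) :
    hammingNorm (pairVec β β' n v) =
      (Finset.univ.filter fun i => v.1 i ≠ 0 ∨ v.2 i ≠ 0).card := by
  rw [hammingNorm]
  congr 1
  ext i
  rw [Finset.mem_filter_univ, Finset.mem_filter_univ, pairVec_apply, ← not_and_or, not_iff_not]
  exact ⟨LinearIndependent.pair_iff.1 hβ _ _, fun h => by rw [h.1, h.2, zero_smul, zero_smul,
    add_zero]⟩

/-- The q-th power map fixes `F` and swaps `β` with `β^q`. The mixed terms cancel and `β^{2q} - β^2`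
factors out of the numerator. -/
theorem traceAlt_pairVec (p : ℕ) [Fact p.Prime] [Fintype F] [Algebra (ZMod p) F]
    (hK : Module.finrank F K = 2) {β : K} (hβ : LinearIndependent F ![β, β ^ Fintype.card F])
    (v w : (Fin n → F) × (Fin n → F)) :
    traceAlt p F hK β (pairVec β (β ^ Fintype.card F) n v)
      (pairVec β (β ^ Fintype.card F) n w) = sympForm p F n v w := by
  have : FiniteDimensional F K := FiniteDimensional.of_finrank_pos (by omega)
  have : Finite K := Module.finite_of_finite F
  have := Fintype.ofFinite K
  have hββ : (β ^ Fintype.card F) ^ Fintype.card F = β := by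
    rw [← pow_mul, ← sq, ← hK, ← Module.card_eq_pow_finrank (K := F) (V := K)]
    exact FiniteField.pow_card β
  -- Otherwise `β^q = ±β`, against linear independence.
  have hD : β ^ (2 * Fintype.card F) - β ^ 2 ≠ 0 := by
    intro h
    have h1 : (β ^ Fintype.card F - β) * (β ^ Fintype.card F + β) = 0 := by
      rw [← h, mul_comm 2, pow_mul]
      ring
    rcases mul_eq_zero.1 h1 with h2 | h2
    · have := (LinearIndependent.pair_iff.1 hβ (-1) 1 (by
        rw [← h2, neg_smul, one_smul, one_smul]
        ring)).2
      exact one_ne_zero this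
    · have := (LinearIndependent.pair_iff.1 hβ 1 1 (by rw [← h2, one_smul, one_smul]; ring)).2
      exact one_ne_zero this
  rw [traceAlt, sympForm_apply]
  congr 1
  apply (algebraMap F K).injective
  rw [Classical.choose_spec (exists_altQuotient F hK β (pairVec β (β ^ Fintype.card F) n v)
    (pairVec β (β ^ Fintype.card F) n w)), div_eq_iff hD]
  have hpow : ∀ (u : (Fin n → F) × (Fin n → F)) (i : Fin n),
      (pairVec β (β ^ Fintype.card F) n u i) ^ Fintype.card F =
        u.1 i • β ^ Fintype.card F + u.2 i • β := by
    intro u i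
    change FiniteField.frobeniusAlgHom F K _ = _
    rw [pairVec_apply, map_add, map_smul, map_smul]
    change u.1 i • β ^ Fintype.card F + u.2 i • (β ^ Fintype.card F) ^ Fintype.card F = _
    rw [hββ]
  simp only [dotProduct, Pi.pow_apply, hpow, map_sub, map_sum, ← Finset.sum_sub_distrib,
    Finset.sum_mul]
  refine Finset.sum_congr rfl fun i _ => ?_
  rw [pairVec_apply, pairVec_apply]
  simp only [Algebra.smul_def, map_mul]
  ring

end Coordinates

end

/-! ### Transfer to additive codes over `F_{q²}` -/

theorem theorem5 (p : ℕ) [Fact p.Prime]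
    (F K : Type*) [Field F] [Fintype F] [DecidableEq F] [Algebra (ZMod p) F]
    [Field K] [DecidableEq K] [Algebra F K] (hK : Module.finrank F K = 2)
    (β : K) (hβ : LinearIndependent F ![β, β ^ Fintype.card F])
    (n : ℕ) (X : AddSubgroup (Fin n → K)) (hX : X ≠ ⊥)
    (Xp Y Yp : Set (Fin n → K))
    (hXp : Xp = altPerp p F hK β (X : Set (Fin n → K)))
    (hY : Y = (X : Set (Fin n → K)) ∩ Xp)
    (hYp : Yp = altPerp p F hK β Y) :
    ∃ (a b : ℕ) (Q : OQECC (Fin n → F) a b),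
      (a : ℝ) = (Fintype.card F : ℝ) ^ n / √((Nat.card X : ℝ) * (Nat.card Y : ℝ)) ∧
      (b : ℝ) = √((Nat.card X : ℝ) / (Nat.card Y : ℝ)) ∧
      Q.minDist p = minWt (((X : Set (Fin n → K)) + Xp) \ (X : Set (Fin n → K))) ∧
      minWt (((X : Set (Fin n → K)) + Xp) \ (X : Set (Fin n → K))) =
        minWt (Yp \ (X : Set (Fin n → K))) ∧
      (∀ e ∈ errorGroup p F n, ∀ w : ℕ, HasErrorWeight p e.1 w →
        (w : ℕ∞) < Q.minDist p → Q.Detects e.1) ∧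
      (∀ t : ℕ, ((2 * t + 1 : ℕ) : ℕ∞) ≤ Q.minDist p →
        Q.Corrects {M | ∃ e ∈ errorGroup p F n, ∃ w : ℕ,
          HasErrorWeight p e.1 w ∧ w ≤ t ∧ M = e.1}) := by
  classical
  set ψ := pairVec (F := F) β (β ^ Fintype.card F) n with hψ
  have hbij : Function.Bijective ψ := pairVec_bijective hK hβ
  let ψe : ((Fin n → F) × (Fin n → F)) ≃ (Fin n → K) := Equiv.ofBijective ψ hbij
  let X' : Submodule (ZMod p) ((Fin n → F) × (Fin n → F)) :=
    AddSubgroup.toZModSubmodule p (X.comap ψ)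
  let B := sympForm p F n
  have hmX : ∀ v, v ∈ X' ↔ ψ v ∈ X := fun v => Iff.rfl
  have hperp : ∀ (S : Set (Fin n → K)) (T : Submodule (ZMod p) ((Fin n → F) × (Fin n → F))),
      (∀ v, v ∈ T ↔ ψ v ∈ S) → ∀ v, v ∈ B.orthogonal T ↔ ψ v ∈ altPerp p F hK β S := by
    intro S T hST v
    rw [LinearMap.BilinForm.mem_orthogonal_iff]
    constructor
    · intro h u hu
      obtain ⟨w, rfl⟩ := hbij.2 u
      rw [traceAlt_pairVec p hK hβ]
      exact h w ((hST w).2 hu)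
    · intro h w hw
      have := h _ ((hST w).1 hw)
      rwa [traceAlt_pairVec p hK hβ] at this
  have hmXp : ∀ v, v ∈ B.orthogonal X' ↔ ψ v ∈ Xp := by
    rw [hXp]
    exact hperp _ _ hmX
  have hmY : ∀ v, v ∈ X' ⊓ B.orthogonal X' ↔ ψ v ∈ Y := fun v => by
    rw [hY, Submodule.mem_inf, hmX, hmXp]
    rfl
  have hmYp : ∀ v, v ∈ X' ⊔ B.orthogonal X' ↔ ψ v ∈ Yp := by
    rw [hYp, ← (sympForm_nondegenerate p).orthogonal_inf_orthogonal (sympForm_isAlt p).isRefl X']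
    exact hperp _ _ hmY
  have hsum : (X : Set (Fin n → K)) + Xp = Yp := by
    ext z
    obtain ⟨v, rfl⟩ := hbij.2 z
    rw [← hmYp, Set.mem_add, Submodule.mem_sup]
    constructor
    · rintro ⟨x, hx, y, hy, hxy⟩
      obtain ⟨x, rfl⟩ := hbij.2 x
      obtain ⟨y, rfl⟩ := hbij.2 y
      exact ⟨x, hx, y, (hmXp y).2 hy, hbij.1 (by rw [map_add, hxy])⟩
    · rintro ⟨x, hx, y, hy, rfl⟩
      exact ⟨ψ x, hx, ψ y, (hmXp y).1 hy, (map_add ψ x y).symm⟩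
  have hcX : Nat.card X' = Nat.card X := Nat.card_congr (ψe.subtypeEquiv hmX)
  have hcY : Nat.card (X' ⊓ B.orthogonal X' : Submodule (ZMod p) _) = Nat.card Y :=
    Nat.card_congr (ψe.subtypeEquiv hmY)
  obtain ⟨a, b, l, Q, ha, hb, hl, hdet, hcomm⟩ := exists_subsystem_code_detects p X'
  rw [hcX] at hb
  rw [hcX, hcY] at hl
  have hndet : ∀ v, ¬ Q.Detects (weyl p v) ↔ ψ v ∈ Yp \ (X : Set (Fin n → K)) := fun v => by
    rw [hdet, not_not, hmYp, hmX]
    rfl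
  have hwt : ∀ (e : Matrix (Fin n → F) (Fin n → F) ℂ) (w : ℕ), HasErrorWeight p e w →
      ∃ (c : ℂ) (v : _), e = c • weyl p v ∧ hammingNorm (ψ v) = w := by
    rintro e w ⟨c, x, z, -, rfl, hw⟩
    exact ⟨c, (x, z), by rw [errX_mul_errZ], by rw [hψ, hammingNorm_pairVec hβ]; exact hw⟩
  have hmin : ∀ v, ψ v ∈ Yp \ (X : Set (Fin n → K)) → Q.minDist p ≤ hammingNorm (ψ v) := by
    intro v hv
    obtain ⟨e, heE, he⟩ := weyl_mem_errorGroup p v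
    refine sInf_le ⟨e, heE, ?_, hammingNorm (ψ v), ⟨1, v.1, v.2, one_ne_zero, ?_, ?_⟩, rfl⟩
    · rw [he]
      exact (hndet v).2 hv
    · rw [errX_mul_errZ, one_smul, he]
    · rw [hψ, hammingNorm_pairVec hβ]
  have hdist : Q.minDist p = minWt (Yp \ (X : Set (Fin n → K))) := by
    apply le_antisymm
    · refine le_iInf₂ fun z hz => ?_
      obtain ⟨v, rfl⟩ := hbij.2 z
      exact hmin v hz
    · refine le_sInf ?_
      rintro _ ⟨e, -, hed, w, hew, rfl⟩
      obtain ⟨c, v, hev, rfl⟩ := hwt _ w hew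
      refine iInf₂_le (ψ v) ((hndet v).1 fun h => hed ?_)
      rw [hev]
      exact Q.detects_smul h c
  have hxpos : (0 : ℝ) < Nat.card X := Nat.cast_pos.2 (hcX ▸ Nat.card_pos)
  have hypos : (0 : ℝ) < Nat.card Y := Nat.cast_pos.2 (hcY ▸ Nat.card_pos)
  have hl' : (l : ℝ) * l = Nat.card X * Nat.card Y := by exact_mod_cast hl
  have hlpos : (0 : ℝ) < l := by
    refine (Nat.cast_nonneg l).lt_of_ne fun h => ?_
    rw [← h, zero_mul] at hl'
    exact (mul_pos hxpos hypos).ne hl'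
  have hb' : (b : ℝ) * l = Nat.card X := by exact_mod_cast hb
  refine ⟨a, b, Q, ?_, ?_, ?_, ?_, ?_, ?_⟩
  · rw [← hl', Real.sqrt_mul_self hlpos.le, eq_div_iff hlpos.ne']
    exact_mod_cast ha
  · symm
    rw [Real.sqrt_eq_iff_mul_self_eq (by positivity) (Nat.cast_nonneg b), div_eq_iff hypos.ne']
    -- Only `b l = x` and `l² = xy` are known; multiplying by `x` turns `b² y` into `(b l)²`.
    apply mul_left_cancel₀ hxpos.ne'
    symm
    calc (Nat.card X : ℝ) * (b * b * Nat.card Y) = b * b * (Nat.card X * Nat.card Y) := by ring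
      _ = (b * l) * (b * l) := by rw [← hl']; ring
      _ = _ := by rw [hb']
  · rw [hsum, hdist]
  · rw [hsum]
  · intro e he w hw hlt
    by_contra hed
    exact hlt.not_ge (sInf_le ⟨e, he, hed, w, hw, rfl⟩)
  · intro t ht
    let κ := {v : (Fin n → F) × (Fin n → F) // hammingNorm (ψ v) ≤ t}
    refine OQECC.Corrects.mono (Q.corrects_of_detects (κ := κ) (fun v => weyl p v.1)
      (fun v => weyl_conjTranspose_mul_self p v.1) (fun v w => ?_) fun v w => ?_) ?_
    · obtain ⟨c, hc⟩ := exists_weyl_conjTranspose_mul p v.1 w.1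
      rw [hc]
      refine Q.detects_smul ?_ c
      by_contra hnd
      have h1 := ht.trans (hmin _ ((hndet _).1 hnd))
      rw [map_sub] at h1
      -- An undetectable difference would have weight at least `2t + 1`, contradicting the triangle
      -- inequality.
      have h2 : hammingNorm (ψ w.1 - ψ v.1) ≤ t + t := by
        rw [sub_eq_neg_add, ← hammingDist_eq_hammingNorm]
        refine (hammingDist_triangle _ 0 _).trans ?_
        rw [hammingDist_zero_right, hammingDist_zero_left]
        exact add_le_add v.2 w.2
      have h3 := Nat.cast_le.1 h1
      omega
    · obtain ⟨c, hc⟩ := exists_weyl_conjTranspose_mul p v.1 w.1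
      rcases hcomm (w.1 - v.1) with h | h
      · left
        rw [hc, Matrix.mul_smul, Matrix.smul_mul, h, smul_zero]
      · right
        -- If the relative error commutes with the projector, both errors carry the code to the same
        -- subspace.
        have h' : (weyl p v.1)ᴴ * weyl p w.1 * Q.proj = Q.proj * ((weyl p v.1)ᴴ * weyl p w.1) := by
          rw [hc, Matrix.smul_mul, h, Matrix.mul_smul]
        symm
        calc weyl p w.1 * Q.proj * (weyl p w.1)ᴴ =
              weyl p v.1 * (weyl p v.1)ᴴ * (weyl p w.1 * Q.proj * (weyl p w.1)ᴴ) := by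
              rw [weyl_mul_conjTranspose_self, Matrix.one_mul]
          _ = weyl p v.1 * ((weyl p v.1)ᴴ * weyl p w.1 * Q.proj) * (weyl p w.1)ᴴ := by
              simp only [Matrix.mul_assoc]
          _ = weyl p v.1 * Q.proj * (weyl p v.1)ᴴ * (weyl p w.1 * (weyl p w.1)ᴴ) := by
              rw [h']
              simp only [Matrix.mul_assoc]
          _ = _ := by rw [weyl_mul_conjTranspose_self, Matrix.mul_one]
    · rintro _ ⟨e, -, w, hw, hwt', rfl⟩
      obtain ⟨c, v, hev, hv⟩ := hwt _ w hw
      exact ⟨c, ⟨v, hv.trans_le hwt'⟩, hev⟩
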